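/- For $\operatorname{Im}\tau>0$ and real $s$ write $q^{s}:=e^{2\pi i s\tau}$ and put $$\lambda(\tau):=16\,q^{1/2}\prod_{n=1}^{\infty}\frac{(1+q^{n})^{8}}{(1+q^{n-1/2})^{8}},\qquad j(\tau):=2^{8}\,\frac{(1-\lambda(\tau)+\lambda(\tau)^{2})^{3}}{\lambda(\tau)^{2}(1-\lambda(\tau))^{2}} .$$ For a real number $d>0$ let $\sqrt{-d}:=i\sqrt d$, $j_d:=j\left(\frac{1+\sqrt{-d}}{2}\right)$, and $$\beta_d:=\sqrt{1728j_d^{2}-j_d^{3}},$$ $$t_d:=-\tfrac{1}{768}\Bigl(\bigl(-884736j_d+2304j_d^{2}-j_d^{3}-12288\sqrt3\,\beta_d\bigr)^{1/3}+\bigl(-884736j_d+2304j_d^{2}-j_d^{3}+12288\sqrt3\,\beta_d\bigr)^{1/3}\Bigr),$$ $$a_d:=\tfrac1{48}\Bigl(\sqrt{1728-j_d}+\bigl(\beta_d-24\sqrt3 j_d\bigr)^{1/3}+\bigl(\beta_d+24\sqrt3 j_d\bigr)^{1/3}\Bigr),$$ $$b_d:=\tfrac1{48}\sqrt{\Bigl(\sqrt3\bigl((\beta_d-24\sqrt3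 j_d)^{1/3}-(\beta_d+24\sqrt3 j_d)^{1/3}\bigr)+24\Bigr)^{2}+1152-9j_d},$$ $$c_d:=\tfrac1{48}\sqrt{-2304t_d+1728-3j_d},$$ where all square and cube roots are principal values. Then for every real $d\ge 3$ $$\alpha_d:=\frac14\left(\sqrt{\frac{1-\lambda(\sqrt{-d})}{\lambda(\sqrt{-d})}}-\sqrt{\frac{\lambda(\sqrt{-d})}{1-\lambda(\sqrt{-d})}}\right)=a_d=b_d=c_d,$$ and this common value is a nonnegative real number. Moreover, the following identity between real radicals (the case $d=11$) holds: $$7\sqrt{11}+8\bigl((7\sqrt{11}+3\sqrt3)^{1/3}+(7\sqrt{11}-3\sqrt3)^{1/3}\bigr)$$ $$=\sqrt{\bigl(8\sqrt3\bigl((7\sqrt{11}+3\sqrt3)^{1/3}-(7\sqrt{11}-3\sqrt3)^{1/3}\bigr)+3\bigr)^{2}+4626}$$ $$=\sqrt{48\bigl((35099+21\sqrt{33})^{1/3}+(35099-21\sqrt{33})^{1/3}\bigr)+1563},$$ and the common value is $68.60158545708098436381847267122362501672364940828\cdots$ (all 47 decimals correct). -/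

import Mathlib

noncomputable section

namespace CubicIdentities

/-- The principal square root of a complex number (the usual one on `[0, ∞)`). -/
def csqrt (z : ℂ) : ℂ := z ^ (1 / 2 : ℂ)

/-- The principal cube root of a complex number (the usual one on `[0, ∞)`). -/
def ccbrt (z : ℂ) : ℂ := z ^ (1 / 3 : ℂ)

/-- The power `q ^ s` of the nome `q = exp (2 π i τ)`, that is `exp (2 π i s τ)`. -/
def qpow (τ : ℂ) (s : ℝ) : ℂ := Complex.exp (2 * Real.pi * Complex.I * s * τ)

/-- The elliptic lambda function
`λ(τ) = 16 q^(1/2) ∏_{n ≥ 1} (1 + q^n)^8 / (1 + q^(n - 1/2))^8`, for `Im τ > 0`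
(the product index `n` below starts at `0`). -/
def ellipticLambda (τ : ℂ) : ℂ :=
  16 * qpow τ (1 / 2) *
    ∏' n : ℕ, (1 + qpow τ ((n : ℝ) + 1)) ^ 8 / (1 + qpow τ ((n : ℝ) + 1 - 1 / 2)) ^ 8

/-- The elliptic modular function
`j(τ) = 2^8 (1 - λ + λ^2)^3 / (λ^2 (1 - λ)^2)` with `λ = λ(τ)`, for `Im τ > 0`. -/
def ellipticJ (τ : ℂ) : ℂ :=
  2 ^ 8 * (1 - ellipticLambda τ + ellipticLambda τ ^ 2) ^ 3 /
    (ellipticLambda τ ^ 2 * (1 - ellipticLambda τ) ^ 2)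

/-- `√(-d)` for `d > 0`, the point of the upper half plane on the imaginary axis. -/
def sqrtNeg (d : ℝ) : ℂ := (Real.sqrt d : ℂ) * Complex.I

/-- `j_d = j((1 + √(-d)) / 2)`. -/
def jd (d : ℝ) : ℂ := ellipticJ ((1 + sqrtNeg d) / 2)

/-- `√3` as a complex number. -/
def sqrt3 : ℂ := (Real.sqrt 3 : ℂ)

def betad (d : ℝ) : ℂ := csqrt (1728 * jd d ^ 2 - jd d ^ 3)

def td (d : ℝ) : ℂ :=
  -(1 / 768) *
    (ccbrt (-884736 * jd d + 2304 * jd d ^ 2 - jd d ^ 3 - 12288 * sqrt3 * betad d) +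
      ccbrt (-884736 * jd d + 2304 * jd d ^ 2 - jd d ^ 3 + 12288 * sqrt3 * betad d))

def ad (d : ℝ) : ℂ :=
  1 / 48 *
    (csqrt (1728 - jd d) + ccbrt (betad d - 24 * sqrt3 * jd d) +
      ccbrt (betad d + 24 * sqrt3 * jd d))

def bd (d : ℝ) : ℂ :=
  1 / 48 *
    csqrt ((sqrt3 * (ccbrt (betad d - 24 * sqrt3 * jd d) -
      ccbrt (betad d + 24 * sqrt3 * jd d)) + 24) ^ 2 + 1152 - 9 * jd d)

def cd (d : ℝ) : ℂ := 1 / 48 * csqrt (-2304 * td d + 1728 - 3 * jd d)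

def alphad (d : ℝ) : ℂ :=
  1 / 4 *
    (csqrt ((1 - ellipticLambda (sqrtNeg d)) / ellipticLambda (sqrtNeg d)) -
      csqrt (ellipticLambda (sqrtNeg d) / (1 - ellipticLambda (sqrtNeg d))))

end CubicIdentities

end

open Filter Topology Complex

/-! Everything depends on one real parameter, b = 2α_d. With x = λ(1 - λ) at √(-d), the definition
of α_d gives b² + 1 = 1/(4x), while j_d = -16(1 - 16x)³/x (`jd_eq`); hence -j_d = 64(b² - 3)³/(b² +
1)², the function `negJ`. In this parametrisation 1728 - j_d is the square, and every cube-root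
radicand the cube, of a rational function of b and √3 (`sqrtRad_sq`, `cbrtRad_cube`,
`cbrtRadT_cube`), so the three closed forms become rational identities in b.

Principal values select these roots because they are nonnegative once b ≥ √3, that is x ≤ 1/16. This
is where d ≥ 3 enters: j vanishes at exp(πi/3), so x = 1/16 at d = 3, and on the imaginary axis λ
decreases with height and equals 1/2 at i.

The behaviour of λ comes from theta constants. The Jacobi triple product turns its product into
θ₂⁴/θ₃⁴; splitting a double series gives Landen's transformation and Jacobi's quartic identity; the
functional equation of theta gives λ(-1/τ) = 1 - λ(τ).

The identities for d = 11 use the same radicals at a real b with `negJ b = 32768`, found by the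
intermediate value theorem; j_11 itself is never evaluated. -/

namespace CubicIdentities

/-! ### The Jacobi triple product -/

/-- The `q`-factorial product `(1 - q) (1 - q ^ 2) ⋯ (1 - q ^ n)`. -/
noncomputable def qFac (q : ℂ) (n : ℕ) : ℂ := ∏ i ∈ Finset.range n, (1 - q ^ (i + 1))

lemma qFac_zero (q : ℂ) : qFac q 0 = 1 := by simp [qFac]

lemma qFac_succ (q : ℂ) (n : ℕ) : qFac q (n + 1) = qFac q n * (1 - q ^ (n + 1)) := by
  simp [qFac, Finset.prod_range_succ]

lemma one_sub_pow_ne_zero {q : ℂ} (hq : ‖q‖ < 1) {n : ℕ} (hn : n ≠ 0) : 1 - q ^ n ≠ 0 := by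
  intro h
  have h1 : ‖q ^ n‖ = 1 := by rw [← sub_eq_zero.mp h]; simp
  rw [norm_pow] at h1
  exact (pow_lt_one₀ (norm_nonneg q) hq hn).ne h1

lemma qFac_ne_zero {q : ℂ} (hq : ‖q‖ < 1) (n : ℕ) : qFac q n ≠ 0 :=
  Finset.prod_ne_zero_iff.mpr fun i _ => one_sub_pow_ne_zero hq i.succ_ne_zero

/-- The `q`-binomial theorem. -/
lemma prod_one_add_mul_pow {q : ℂ} (hq : ‖q‖ < 1) (x : ℂ) (N : ℕ) :
    ∏ k ∈ Finset.range N, (1 + x * q ^ k) =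
      ∑ k ∈ Finset.range (N + 1),
        q ^ (k.choose 2) * (qFac q N / (qFac q k * qFac q (N - k))) * x ^ k := by
  induction N with
  | zero => simp [qFac_zero]
  | succ N ih =>
    rw [Finset.prod_range_succ, ih, mul_add, mul_one, Finset.sum_mul]
    conv_lhs => enter [1]; rw [Finset.sum_range_succ']
    conv_lhs => enter [2]; rw [Finset.sum_range_succ]
    conv_rhs => rw [Finset.sum_range_succ', Finset.sum_range_succ]
    -- The q-Pascal rule [N+1, k+1] = [N, k+1] + q^(N-k) [N, k], multiplied by the powers of q and
    -- x.
    have key : ∀ k ∈ Finset.range N,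
        q ^ ((k + 1).choose 2) * (qFac q (N + 1) / (qFac q (k + 1) * qFac q (N + 1 - (k + 1)))) *
            x ^ (k + 1) =
          q ^ ((k + 1).choose 2) * (qFac q N / (qFac q (k + 1) * qFac q (N - (k + 1)))) *
            x ^ (k + 1) +
          q ^ (k.choose 2) * (qFac q N / (qFac q k * qFac q (N - k))) * x ^ k * (x * q ^ N) := by
      intro k hk
      obtain ⟨m, rfl⟩ : ∃ m, N = k + 1 + m := ⟨N - (k + 1), by have := Finset.mem_range.mp hk; omega⟩
      have e1 : k + 1 + m + 1 - (k + 1) = m + 1 := by omega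
      have e2 : k + 1 + m - (k + 1) = m := by omega
      have e3 : k + 1 + m - k = m + 1 := by omega
      rw [e1, e2, e3, qFac_succ q (k + 1 + m), qFac_succ q m, qFac_succ q k,
        Nat.choose_succ_succ' k 1, Nat.choose_one_right]
      have h1 := qFac_ne_zero hq k
      have h2 := qFac_ne_zero hq m
      have h3 := one_sub_pow_ne_zero hq k.succ_ne_zero
      have h4 := one_sub_pow_ne_zero hq m.succ_ne_zero
      field_simp
      ring
    rw [Finset.sum_congr rfl key, Finset.sum_add_distrib]
    have h1 := qFac_ne_zero hq N
    have h2 := qFac_ne_zero hq (N + 1)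
    have e : (N + 1).choose 2 = N + N.choose 2 := by
      rw [Nat.choose_succ_succ' N 1, Nat.choose_one_right]
    simp only [Nat.sub_self, Nat.sub_zero, qFac_zero, Nat.choose_zero_succ, pow_zero, e]
    simp only [mul_one, one_mul, div_self h1, div_self h2]
    ring

lemma prod_mul_zpow_neg_odd {p z : ℂ} (hp : p ≠ 0) (n : ℕ) :
    ∏ k ∈ Finset.range n, (z * p ^ (-(2 * (k : ℤ) + 1))) = z ^ n * p ^ (-(n : ℤ) ^ 2) := by
  induction n with
  | zero => simp
  | succ n ih =>
    rw [Finset.prod_range_succ, ih, pow_succ,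
      show (-((n + 1 : ℕ) : ℤ) ^ 2) = -(n : ℤ) ^ 2 + -(2 * (n : ℤ) + 1) by push_cast; ring,
      zpow_add₀ hp]
    exact mul_mul_mul_comm _ _ _ _

/-- The finite form of the Jacobi triple product identity. -/
lemma prod_theta_factors {p z : ℂ} (hp0 : p ≠ 0) (hp : ‖p‖ < 1) (hz : z ≠ 0) (n : ℕ) :
    ∏ k ∈ Finset.range n, ((1 + z * p ^ (2 * k + 1)) * (1 + z⁻¹ * p ^ (2 * k + 1))) =
      ∑ k ∈ Finset.range (2 * n + 1),
        (qFac (p ^ 2) (2 * n) / (qFac (p ^ 2) k * qFac (p ^ 2) (2 * n - k))) *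
          (z ^ ((k : ℤ) - n) * p ^ (((k : ℤ) - n) ^ 2)) := by
  have hq : ‖p ^ 2‖ < 1 := by
    rw [norm_pow]; exact pow_lt_one₀ (norm_nonneg p) hp two_ne_zero
  -- This choice makes the exponents of p run over the odd numbers from 1 - 2n to 2n - 1. Drawing z
  -- p^(-(2k+1)) out of each factor with negative exponent leaves the factors in z⁻¹.
  have h := prod_one_add_mul_pow hq (z * p ^ (1 - 2 * (n : ℤ))) (2 * n)
  have hL : ∏ k ∈ Finset.range (2 * n), (1 + z * p ^ (1 - 2 * (n : ℤ)) * (p ^ 2) ^ k) =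
      z ^ n * p ^ (-(n : ℤ) ^ 2) *
        ∏ k ∈ Finset.range n, ((1 + z * p ^ (2 * k + 1)) * (1 + z⁻¹ * p ^ (2 * k + 1))) := by
    have hsplit : z ^ n * p ^ (-(n : ℤ) ^ 2) *
          ∏ k ∈ Finset.range n, ((1 + z * p ^ (2 * k + 1)) * (1 + z⁻¹ * p ^ (2 * k + 1))) =
        (∏ k ∈ Finset.range n, (z * p ^ (-(2 * (k : ℤ) + 1)) * (1 + z⁻¹ * p ^ (2 * k + 1)))) *
          ∏ k ∈ Finset.range n, (1 + z * p ^ (2 * k + 1)) := by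
      rw [← prod_mul_zpow_neg_odd hp0, ← Finset.prod_mul_distrib, ← Finset.prod_mul_distrib]
      exact Finset.prod_congr rfl fun k _ => by ring
    rw [hsplit, two_mul n, Finset.prod_range_add,
      ← Finset.prod_range_reflect (fun k => 1 + z * p ^ (1 - 2 * (n : ℤ)) * (p ^ 2) ^ k) n]
    refine congrArg₂ (fun a b : ℂ => a * b) (Finset.prod_congr rfl fun k hk => ?_)
      (Finset.prod_congr rfl fun k _ => ?_)
    · have hk := Finset.mem_range.mp hk
      have e : p ^ (1 - 2 * (n : ℤ)) * (p ^ 2) ^ (n - 1 - k) = p ^ (-(2 * (k : ℤ) + 1)) := by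
        rw [← pow_mul, ← zpow_natCast p (2 * (n - 1 - k)), ← zpow_add₀ hp0]
        congr 1
        omega
      have e' : p ^ (-(2 * (k : ℤ) + 1)) * p ^ (2 * k + 1) = 1 := by
        rw [← zpow_natCast p (2 * k + 1), ← zpow_add₀ hp0]
        simp
      rw [mul_assoc, e, mul_add, mul_one]
      calc 1 + z * p ^ (-(2 * (k : ℤ) + 1))
          = z * p ^ (-(2 * (k : ℤ) + 1)) +
              z * z⁻¹ * (p ^ (-(2 * (k : ℤ) + 1)) * p ^ (2 * k + 1)) := by
            rw [mul_inv_cancel₀ hz, e']; ring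
        _ = _ := by ring
    · have e : p ^ (1 - 2 * (n : ℤ)) * (p ^ 2) ^ (n + k) = p ^ (2 * k + 1) := by
        rw [← pow_mul, ← zpow_natCast p (2 * (n + k)), ← zpow_add₀ hp0, ← zpow_natCast p (2 * k + 1)]
        congr 1
        push_cast; ring
      rw [mul_assoc, e]
  rw [hL] at h
  have hne : z ^ n * p ^ (-(n : ℤ) ^ 2) ≠ 0 := mul_ne_zero (pow_ne_zero _ hz) (zpow_ne_zero _ hp0)
  apply mul_left_cancel₀ hne
  rw [h, Finset.mul_sum]
  refine Finset.sum_congr rfl fun k _ => ?_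
  have e1 : z ^ k = z ^ n * z ^ ((k : ℤ) - n) := by
    rw [← zpow_natCast z k, ← zpow_natCast z n, ← zpow_add₀ hz]; congr 1; ring
  have e2 : (p ^ 2) ^ (k.choose 2) * (p ^ (1 - 2 * (n : ℤ))) ^ k =
      p ^ (-(n : ℤ) ^ 2) * p ^ (((k : ℤ) - n) ^ 2) := by
    have hc : ((2 * k.choose 2 : ℕ) : ℤ) = k * (k - 1) := by
      rcases k with _ | k
      · simp
      · rw [Nat.choose_two_right, Nat.mul_div_cancel' (Nat.even_mul_pred_self _).two_dvd]
        push_cast; simp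
    rw [← pow_mul, ← zpow_natCast p (2 * k.choose 2), ← zpow_natCast (p ^ (1 - 2 * (n : ℤ))) k,
      ← zpow_mul, ← zpow_add₀ hp0, ← zpow_add₀ hp0, hc]
    congr 1
    ring
  rw [mul_pow, e1]
  linear_combination (z ^ n * z ^ ((k : ℤ) - n) *
    (qFac (p ^ 2) (2 * n) / (qFac (p ^ 2) k * qFac (p ^ 2) (2 * n - k)))) * e2

lemma summable_norm_pow_mul_add {p : ℂ} (hp : ‖p‖ < 1) {a : ℕ} (ha : a ≠ 0) (b : ℕ) :
    Summable fun n : ℕ => ‖p ^ (a * n + b)‖ := by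
  have h : Summable fun n : ℕ => ‖p ^ b‖ * (‖p‖ ^ a) ^ n :=
    (summable_geometric_of_lt_one (by positivity) (pow_lt_one₀ (norm_nonneg p) hp ha)).mul_left _
  refine h.congr fun n => ?_
  rw [norm_pow, norm_pow, pow_add, pow_mul, mul_comm]

lemma summable_norm_mul_pow_mul_add {p : ℂ} (hp : ‖p‖ < 1) (c : ℂ) {a : ℕ} (ha : a ≠ 0) (b : ℕ) :
    Summable fun n : ℕ => ‖c * p ^ (a * n + b)‖ := by
  simp only [norm_mul]
  exact (summable_norm_pow_mul_add hp ha b).mul_left _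

lemma multipliable_one_add_mul_pow {p : ℂ} (hp : ‖p‖ < 1) (c : ℂ) {a : ℕ} (ha : a ≠ 0) (b : ℕ) :
    Multipliable fun n : ℕ => 1 + c * p ^ (a * n + b) :=
  multipliable_one_add_of_summable (summable_norm_mul_pow_mul_add hp c ha b)

/-- `∏ (1 - p ^ (2 n))` over `n ≥ 1`. -/
noncomputable def evenSubProd (p : ℂ) : ℂ := ∏' n : ℕ, (1 + -1 * p ^ (2 * n + 2))

/-- `∏ (1 + p ^ (2 n))` over `n ≥ 1`. -/
noncomputable def evenAddProd (p : ℂ) : ℂ := ∏' n : ℕ, (1 + 1 * p ^ (2 * n + 2))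

/-- `∏ (1 + p ^ (2 n - 1))` over `n ≥ 1`. -/
noncomputable def oddAddProd (p : ℂ) : ℂ := ∏' n : ℕ, (1 + 1 * p ^ (2 * n + 1))

lemma one_add_mul_pow_ne_zero {p : ℂ} (hp : ‖p‖ < 1) {c : ℂ} (hc : ‖c‖ = 1) {n : ℕ} (hn : n ≠ 0) :
    1 + c * p ^ n ≠ 0 := by
  intro h
  have h1 : ‖c * p ^ n‖ = 1 := by
    rw [eq_neg_of_add_eq_zero_right h]; simp
  rw [norm_mul, hc, one_mul, norm_pow] at h1
  exact (pow_lt_one₀ (norm_nonneg p) hp hn).ne h1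

lemma tprod_one_add_mul_pow_ne_zero {p : ℂ} (hp : ‖p‖ < 1) {c : ℂ} (hc : ‖c‖ = 1) {a b : ℕ}
    (ha : a ≠ 0) (hb : b ≠ 0) : ∏' n : ℕ, (1 + c * p ^ (a * n + b)) ≠ 0 :=
  tprod_one_add_ne_zero_of_summable
    (fun n => one_add_mul_pow_ne_zero hp hc (by omega)) (summable_norm_mul_pow_mul_add hp c ha b)

lemma evenSubProd_ne_zero {p : ℂ} (hp : ‖p‖ < 1) : evenSubProd p ≠ 0 :=
  tprod_one_add_mul_pow_ne_zero hp (by simp) two_ne_zero two_ne_zero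

lemma evenAddProd_ne_zero {p : ℂ} (hp : ‖p‖ < 1) : evenAddProd p ≠ 0 :=
  tprod_one_add_mul_pow_ne_zero hp (by simp) two_ne_zero two_ne_zero

lemma oddAddProd_ne_zero {p : ℂ} (hp : ‖p‖ < 1) : oddAddProd p ≠ 0 :=
  tprod_one_add_mul_pow_ne_zero hp (by simp) two_ne_zero one_ne_zero

lemma tendsto_qFac_sq {p : ℂ} (hp : ‖p‖ < 1) :
    Tendsto (qFac (p ^ 2)) atTop (𝓝 (evenSubProd p)) := by
  have h := (multipliable_one_add_mul_pow hp (-1) two_ne_zero 2).hasProd.tendsto_prod_nat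
  refine h.congr fun n => Finset.prod_congr rfl fun i _ => ?_
  rw [← pow_mul]; ring

/-- The coefficient of `z ^ j` in the finite triple product, without the factor `p ^ (j ^ 2)`. -/
noncomputable def tripleCoeff (p : ℂ) (n : ℕ) (j : ℤ) : ℂ :=
  if j ∈ Finset.Icc (-(n : ℤ)) n then
    qFac (p ^ 2) (2 * n) / (qFac (p ^ 2) ((n : ℤ) + j).toNat * qFac (p ^ 2) ((n : ℤ) - j).toNat)
  else 0

/-- Extending the coefficients by zero gives all n the same index set ℤ, as dominated convergence
requires. -/
lemma prod_theta_factors_eq_tsum {p z : ℂ} (hp0 : p ≠ 0) (hp : ‖p‖ < 1) (hz : z ≠ 0) (n : ℕ) :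
    ∏ k ∈ Finset.range n, ((1 + z * p ^ (2 * k + 1)) * (1 + z⁻¹ * p ^ (2 * k + 1))) =
      ∑' j : ℤ, tripleCoeff p n j * (z ^ j * p ^ (j ^ 2)) := by
  rw [prod_theta_factors hp0 hp hz, tsum_eq_sum (s := Finset.Icc (-(n : ℤ)) n)]
  · refine Finset.sum_nbij' (fun k => (k : ℤ) - n) (fun j => ((n : ℤ) + j).toNat) ?_ ?_ ?_ ?_ ?_
    · intro k hk; simp only [Finset.mem_range, Finset.mem_Icc] at *; omega
    · intro k hk; simp only [Finset.mem_range, Finset.mem_Icc] at *; omega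
    · intro k hk; simp
    · intro k hk; simp only [Finset.mem_Icc] at *; omega
    · intro k hk
      have hk' : (k : ℤ) - n ∈ Finset.Icc (-(n : ℤ)) n := by
        simp only [Finset.mem_range, Finset.mem_Icc] at *; omega
      have e1 : ((n : ℤ) + (k - n)).toNat = k := by omega
      have e2 : ((n : ℤ) - (k - n)).toNat = 2 * n - k := by omega
      rw [tripleCoeff, if_pos hk', e1, e2]
  · intro j hj
    rw [tripleCoeff, if_neg hj, zero_mul]

lemma tendsto_tripleCoeff {p : ℂ} (hp : ‖p‖ < 1) (j : ℤ) :
    Tendsto (fun n => tripleCoeff p n j) atTop (𝓝 (evenSubProd p)⁻¹) := by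
  have h := tendsto_qFac_sq hp
  have hne := evenSubProd_ne_zero hp
  have h1 : Tendsto (fun n : ℕ => 2 * n) atTop atTop := tendsto_id.const_mul_atTop' two_pos
  have h2 : Tendsto (fun n : ℕ => ((n : ℤ) + j).toNat) atTop atTop :=
    tendsto_atTop.mpr fun b => by
      filter_upwards [eventually_ge_atTop (b + j.natAbs)] with n hn; omega
  have h3 : Tendsto (fun n : ℕ => ((n : ℤ) - j).toNat) atTop atTop :=
    tendsto_atTop.mpr fun b => by
      filter_upwards [eventually_ge_atTop (b + j.natAbs)] with n hn; omega
  have h4 := (h.comp h1).div ((h.comp h2).mul (h.comp h3)) (mul_ne_zero hne hne)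
  rw [show evenSubProd p / (evenSubProd p * evenSubProd p) = (evenSubProd p)⁻¹ by
    field_simp] at h4
  refine h4.congr' ?_
  filter_upwards [eventually_ge_atTop j.natAbs] with n hn
  rw [tripleCoeff, if_pos]
  · rfl
  · rw [Finset.mem_Icc]; omega

/-- The q-factorials converge to a nonzero limit, so they and their inverses are bounded; this
supplies the dominating series. -/
lemma exists_norm_tripleCoeff_le {p : ℂ} (hp : ‖p‖ < 1) :
    ∃ C : ℝ, ∀ n j, ‖tripleCoeff p n j‖ ≤ C := by
  have hq : ‖p ^ 2‖ < 1 := by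
    rw [norm_pow]; exact pow_lt_one₀ (norm_nonneg p) hp two_ne_zero
  have h := tendsto_qFac_sq hp
  obtain ⟨A, hA⟩ := h.norm.bddAbove_range
  obtain ⟨B, hB⟩ := (h.inv₀ (evenSubProd_ne_zero hp)).norm.bddAbove_range
  have hA' : ∀ n, ‖qFac (p ^ 2) n‖ ≤ A := fun n => hA ⟨n, rfl⟩
  have hB' : ∀ n, ‖(qFac (p ^ 2) n)⁻¹‖ ≤ B := fun n => hB ⟨n, rfl⟩
  have hA0 : 0 ≤ A := (norm_nonneg _).trans (hA' 0)
  have hB0 : 0 ≤ B := (norm_nonneg _).trans (hB' 0)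
  refine ⟨A * (B * B), fun n j => ?_⟩
  rw [tripleCoeff]
  split_ifs
  · rw [div_eq_mul_inv, mul_inv, norm_mul, norm_mul]
    gcongr
    · exact hA' _
    · exact hB' _
    · exact hB' _
  · rw [norm_zero]; positivity

/-- The Jacobi triple product identity. -/
theorem tsum_zpow_mul_zpow_sq {p z : ℂ} (hp0 : p ≠ 0) (hp : ‖p‖ < 1) (hz : z ≠ 0)
    (hs : Summable fun j : ℤ => z ^ j * p ^ (j ^ 2)) :
    ∑' j : ℤ, z ^ j * p ^ (j ^ 2) =
      evenSubProd p * ((∏' n : ℕ, (1 + z * p ^ (2 * n + 1))) *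
        ∏' n : ℕ, (1 + z⁻¹ * p ^ (2 * n + 1))) := by
  obtain ⟨C, hC⟩ := exists_norm_tripleCoeff_le hp
  have hlim := tendsto_tsum_of_dominated_convergence (𝓕 := atTop)
    (f := fun n j => tripleCoeff p n j * (z ^ j * p ^ (j ^ 2)))
    (g := fun j => (evenSubProd p)⁻¹ * (z ^ j * p ^ (j ^ 2)))
    (hs.norm.mul_left C) (fun j => (tendsto_tripleCoeff hp j).mul_const _)
    (Eventually.of_forall fun n j => by
      rw [norm_mul]; exact mul_le_mul_of_nonneg_right (hC n j) (norm_nonneg _))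
  simp only [← prod_theta_factors_eq_tsum hp0 hp hz] at hlim
  have hprod := ((multipliable_one_add_mul_pow hp z two_ne_zero 1).hasProd.mul
    (multipliable_one_add_mul_pow hp z⁻¹ two_ne_zero 1).hasProd).tendsto_prod_nat
  rw [tendsto_nhds_unique hprod hlim, tsum_mul_left,
    mul_inv_cancel_left₀ (evenSubProd_ne_zero hp)]

/-! ### Theta constants and the transformations of λ -/

/-- The nome `exp (π i τ)`. -/
noncomputable def nome (τ : ℂ) : ℂ := cexp (Real.pi * I * τ)

lemma nome_ne_zero (τ : ℂ) : nome τ ≠ 0 := exp_ne_zero _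

lemma norm_nome_lt_one {τ : ℂ} (hτ : 0 < τ.im) : ‖nome τ‖ < 1 := by
  rw [nome, norm_exp, Real.exp_lt_one_iff]
  simpa using mul_pos Real.pi_pos hτ

lemma nome_add_one (τ : ℂ) : nome (τ + 1) = -nome τ := by
  rw [nome, nome, mul_add, mul_one, exp_add, exp_pi_mul_I]; ring

lemma nome_two_mul (τ : ℂ) : nome (2 * τ) = nome τ ^ 2 := by
  rw [nome, nome, ← exp_nat_mul]; congr 1; push_cast; ring

/-- `θ₃(τ) = ∑ p ^ (n ^ 2)` with `p` the nome of `τ`. -/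
noncomputable def thetaThree (τ : ℂ) : ℂ := jacobiTheta₂ 0 τ

/-- `∑ p ^ (n ^ 2 + n)` with `p` the nome of `τ`, that is `p ^ (-1 / 4) θ₂(τ)`. -/
noncomputable def thetaTwo (τ : ℂ) : ℂ := jacobiTheta₂ (τ / 2) τ

lemma jacobiTheta₂_term_eq (j : ℤ) (w τ : ℂ) :
    jacobiTheta₂_term j w τ = cexp (2 * Real.pi * I * w) ^ j * nome τ ^ (j ^ 2) := by
  rw [jacobiTheta₂_term, nome, exp_add, ← exp_int_mul, ← exp_int_mul]
  congr 2
  · ring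
  · push_cast; ring

lemma jacobiTheta₂_eq_prod (w : ℂ) {τ : ℂ} (hτ : 0 < τ.im) :
    jacobiTheta₂ w τ = evenSubProd (nome τ) *
      ((∏' n : ℕ, (1 + cexp (2 * Real.pi * I * w) * nome τ ^ (2 * n + 1))) *
        ∏' n : ℕ, (1 + (cexp (2 * Real.pi * I * w))⁻¹ * nome τ ^ (2 * n + 1))) := by
  have hs := (summable_jacobiTheta₂_term_iff w τ).mpr hτ
  simp only [jacobiTheta₂_term_eq] at hs
  rw [← tsum_zpow_mul_zpow_sq (nome_ne_zero τ) (norm_nome_lt_one hτ) (exp_ne_zero _) hs,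
    jacobiTheta₂]
  simp only [jacobiTheta₂_term_eq]

lemma thetaThree_eq_prod {τ : ℂ} (hτ : 0 < τ.im) :
    thetaThree τ = evenSubProd (nome τ) * oddAddProd (nome τ) ^ 2 := by
  rw [thetaThree, jacobiTheta₂_eq_prod 0 hτ, mul_zero, exp_zero, inv_one, sq]
  rfl

lemma thetaThree_ne_zero {τ : ℂ} (hτ : 0 < τ.im) : thetaThree τ ≠ 0 := by
  rw [thetaThree_eq_prod hτ]
  have h := norm_nome_lt_one hτ
  exact mul_ne_zero (evenSubProd_ne_zero h) (pow_ne_zero _ (oddAddProd_ne_zero h))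

lemma thetaTwo_eq_prod {τ : ℂ} (hτ : 0 < τ.im) :
    thetaTwo τ = 2 * evenSubProd (nome τ) * evenAddProd (nome τ) ^ 2 := by
  have h := norm_nome_lt_one hτ
  have h0 := nome_ne_zero τ
  have e : cexp (2 * Real.pi * I * (τ / 2)) = nome τ := by rw [nome]; congr 1; ring
  rw [thetaTwo, jacobiTheta₂_eq_prod _ hτ, e]
  have e1 : ∏' n : ℕ, (1 + nome τ * nome τ ^ (2 * n + 1)) = evenAddProd (nome τ) :=
    tprod_congr fun n => by ring
  -- The shifted product starts at exponent 0, and that factor 1 + 1 is the leading 2.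
  have e2 : ∏' n : ℕ, (1 + (nome τ)⁻¹ * nome τ ^ (2 * n + 1)) = 2 * evenAddProd (nome τ) := by
    have e3 : ∀ n : ℕ, 1 + (nome τ)⁻¹ * nome τ ^ (2 * n + 1) = 1 + 1 * nome τ ^ (2 * n + 0) :=
      fun n => by rw [pow_succ', inv_mul_cancel_left₀ h0, one_mul, add_zero]
    rw [tprod_congr e3, tprod_eq_zero_mul']
    · rw [evenAddProd]
      norm_num
      exact tprod_congr fun n => by ring
    · exact (multipliable_one_add_mul_pow h 1 two_ne_zero 2).congr fun n => by ring
  rw [e1, e2]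
  ring

lemma thetaTwo_ne_zero {τ : ℂ} (hτ : 0 < τ.im) : thetaTwo τ ≠ 0 := by
  rw [thetaTwo_eq_prod hτ]
  have h := norm_nome_lt_one hτ
  exact mul_ne_zero (mul_ne_zero two_ne_zero (evenSubProd_ne_zero h))
    (pow_ne_zero _ (evenAddProd_ne_zero h))

lemma ellipticLambda_eq_prod {τ : ℂ} (hτ : 0 < τ.im) :
    ellipticLambda τ = 16 * nome τ * (evenAddProd (nome τ) ^ 8 / oddAddProd (nome τ) ^ 8) := by
  have h := norm_nome_lt_one hτ
  have e1 : qpow τ (1 / 2) = nome τ := by rw [qpow, nome]; congr 1; push_cast; ring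
  have e2 : ∀ n : ℕ, qpow τ ((n : ℝ) + 1) = 1 * nome τ ^ (2 * n + 2) := fun n => by
    rw [qpow, nome, one_mul, ← exp_nat_mul]; congr 1; push_cast; ring
  have e3 : ∀ n : ℕ, qpow τ ((n : ℝ) + 1 - 1 / 2) = 1 * nome τ ^ (2 * n + 1) := fun n => by
    rw [qpow, nome, one_mul, ← exp_nat_mul]; congr 1; push_cast; ring
  have h1 := (multipliable_one_add_mul_pow h 1 two_ne_zero 2).hasProd
  have h2 := (multipliable_one_add_mul_pow h 1 two_ne_zero 1).hasProd
  rw [ellipticLambda, e1]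
  simp only [e2, e3]
  congr 1
  exact ((h1.pow 8).div₀ (h2.pow 8) (pow_ne_zero _ (oddAddProd_ne_zero h))).tprod_eq

lemma ellipticLambda_eq_theta {τ : ℂ} (hτ : 0 < τ.im) :
    ellipticLambda τ = nome τ * thetaTwo τ ^ 4 / thetaThree τ ^ 4 := by
  have h := norm_nome_lt_one hτ
  have h1 := evenSubProd_ne_zero h
  have h2 := oddAddProd_ne_zero h
  rw [ellipticLambda_eq_prod hτ, thetaTwo_eq_prod hτ, thetaThree_eq_prod hτ]
  field_simp
  ring

lemma ellipticLambda_ne_zero {τ : ℂ} (hτ : 0 < τ.im) : ellipticLambda τ ≠ 0 := by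
  rw [ellipticLambda_eq_theta hτ]
  exact div_ne_zero (mul_ne_zero (nome_ne_zero τ) (pow_ne_zero _ (thetaTwo_ne_zero hτ)))
    (pow_ne_zero _ (thetaThree_ne_zero hτ))

lemma evenSubProd_mul_evenAddProd {p : ℂ} (hp : ‖p‖ < 1) :
    evenSubProd p * evenAddProd p = evenSubProd (p ^ 2) := by
  have h1 := (multipliable_one_add_mul_pow hp (-1) two_ne_zero 2)
  have h2 := (multipliable_one_add_mul_pow hp 1 two_ne_zero 2)
  rw [evenSubProd, evenAddProd, ← h1.tprod_mul h2]
  exact tprod_congr fun n => by rw [← pow_mul]; ring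

lemma evenAddProd_eq_mul {p : ℂ} (hp : ‖p‖ < 1) :
    evenAddProd p = oddAddProd (p ^ 2) * evenAddProd (p ^ 2) := by
  have e1 : ∀ k : ℕ, 1 + 1 * (p ^ 2) ^ (2 * k + 1) = 1 + 1 * p ^ (2 * (2 * k) + 2) := fun k => by
    rw [← pow_mul]; ring
  have e2 : ∀ k : ℕ, 1 + 1 * (p ^ 2) ^ (2 * k + 2) = 1 + 1 * p ^ (2 * (2 * k + 1) + 2) :=
    fun k => by rw [← pow_mul]; ring
  have hq : ‖p ^ 2‖ < 1 := by
    rw [norm_pow]; exact pow_lt_one₀ (norm_nonneg p) hp two_ne_zero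
  have h1 := multipliable_one_add_mul_pow hq 1 two_ne_zero 1
  have h2 := multipliable_one_add_mul_pow hq 1 two_ne_zero 2
  rw [evenAddProd, evenAddProd, oddAddProd]
  simp only [e1, e2] at h1 h2 ⊢
  exact (tprod_even_mul_odd (f := fun n : ℕ => 1 + 1 * p ^ (2 * n + 2)) h1 h2).symm

lemma two_mul_im_pos {τ : ℂ} (hτ : 0 < τ.im) : 0 < (2 * τ).im := by simpa using hτ

/-- With E, A, O the even-minus, even-plus and odd-plus products, it follows from E(p)A(p) = E(p²)
and A(p) = O(p²)A(p²). -/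
lemma thetaTwo_sq {τ : ℂ} (hτ : 0 < τ.im) :
    thetaTwo τ ^ 2 = 2 * thetaTwo (2 * τ) * thetaThree (2 * τ) := by
  have h := norm_nome_lt_one hτ
  have h2 := two_mul_im_pos hτ
  rw [thetaTwo_eq_prod hτ, thetaTwo_eq_prod h2, thetaThree_eq_prod h2, nome_two_mul,
    ← evenSubProd_mul_evenAddProd h]
  have e := evenAddProd_eq_mul h
  linear_combination 4 * evenSubProd (nome τ) ^ 2 * evenAddProd (nome τ) ^ 2 *
    (evenAddProd (nome τ) + oddAddProd (nome τ ^ 2) * evenAddProd (nome τ ^ 2)) * e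

/-- Pairs of integers, split by the parity of the sum of their entries. -/
noncomputable def intPairParityEquiv : (ℤ × ℤ) ⊕ (ℤ × ℤ) ≃ ℤ × ℤ :=
  Equiv.ofBijective
    (Sum.elim (fun x => (x.1 + x.2, x.1 - x.2)) (fun x => (x.1 + x.2 + 1, x.1 - x.2))) <| by
  constructor
  · rintro (⟨a, b⟩ | ⟨a, b⟩) (⟨c, d⟩ | ⟨c, d⟩) h <;>
      simp only [Sum.elim_inl, Sum.elim_inr, Prod.mk.injEq] at h
    · rw [show a = c by omega, show b = d by omega]
    · omega
    · omega
    · rw [show a = c by omega, show b = d by omega]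
  · rintro ⟨a, b⟩
    rcases Int.even_or_odd (a + b) with ⟨u, hu⟩ | ⟨u, hu⟩
    · exact ⟨Sum.inl (u, u - b), by simp only [Sum.elim_inl, Prod.mk.injEq]; omega⟩
    · exact ⟨Sum.inr (u, u - b), by simp only [Sum.elim_inr, Prod.mk.injEq]; omega⟩

lemma intPairParityEquiv_inl (x : ℤ × ℤ) :
    intPairParityEquiv (Sum.inl x) = (x.1 + x.2, x.1 - x.2) := rfl

lemma intPairParityEquiv_inr (x : ℤ × ℤ) :
    intPairParityEquiv (Sum.inr x) = (x.1 + x.2 + 1, x.1 - x.2) := rfl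

/-- Landen's transformation for `θ₃`. -/
lemma thetaThree_sq {τ : ℂ} (hτ : 0 < τ.im) :
    thetaThree τ ^ 2 = thetaThree (2 * τ) ^ 2 + nome τ * thetaTwo (2 * τ) ^ 2 := by
  have h2 := two_mul_im_pos hτ
  have s1 := ((summable_jacobiTheta₂_term_iff 0 τ).mpr hτ).norm
  have s2 := ((summable_jacobiTheta₂_term_iff 0 (2 * τ)).mpr h2).norm
  have s3 := ((summable_jacobiTheta₂_term_iff (2 * τ / 2) (2 * τ)).mpr h2).norm
  have m2 := summable_mul_of_summable_norm s2 s2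
  have m3 := (summable_mul_of_summable_norm s3 s3).mul_left (nome τ)
  rw [sq, sq, sq, thetaThree, thetaThree, thetaTwo, jacobiTheta₂, jacobiTheta₂, jacobiTheta₂,
    tsum_mul_tsum_of_summable_norm s1 s1, tsum_mul_tsum_of_summable_norm s2 s2,
    tsum_mul_tsum_of_summable_norm s3 s3, ← tsum_mul_left, ← intPairParityEquiv.tsum_eq]
  -- Equal parities: (m+n)² + (m-n)² = 2(m² + n²). Opposite parities, below: (m+n+1)² + (m-n)² =
  -- 2(m² + m + n² + n) + 1, the final 1 giving the factor `nome τ`.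
  have e1 : ∀ x : ℤ × ℤ,
      jacobiTheta₂_term (intPairParityEquiv (Sum.inl x)).1 0 τ *
        jacobiTheta₂_term (intPairParityEquiv (Sum.inl x)).2 0 τ =
      jacobiTheta₂_term x.1 0 (2 * τ) * jacobiTheta₂_term x.2 0 (2 * τ) := by
    intro x
    simp only [intPairParityEquiv_inl, jacobiTheta₂_term,
      ← exp_add]
    congr 1; push_cast; ring
  have e2 : ∀ x : ℤ × ℤ,
      jacobiTheta₂_term (intPairParityEquiv (Sum.inr x)).1 0 τ *
        jacobiTheta₂_term (intPairParityEquiv (Sum.inr x)).2 0 τ =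
      nome τ * (jacobiTheta₂_term x.1 (2 * τ / 2) (2 * τ) *
        jacobiTheta₂_term x.2 (2 * τ / 2) (2 * τ)) := by
    intro x
    simp only [intPairParityEquiv_inr, jacobiTheta₂_term, nome,
      ← exp_add]
    congr 1; push_cast; ring
  rw [Summable.tsum_sum]
  · simp only [e1, e2]
  · exact m2.congr fun x => (e1 x).symm
  · exact m3.congr fun x => (e2 x).symm

lemma thetaThree_add_two (τ : ℂ) : thetaThree (τ + 2) = thetaThree τ := jacobiTheta₂_add_right 0 τ

/-- The two shifts multiply the n-th term by exp(πi n(n+1)) = 1. -/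
lemma jacobiTheta₂_half_add_one (w τ : ℂ) :
    jacobiTheta₂ (w + 1 / 2) (τ + 1) = jacobiTheta₂ w τ := by
  refine tsum_congr fun n => ?_
  obtain ⟨m, hm⟩ := Int.even_mul_succ_self n
  have hm' : (n : ℂ) * (n + 1) = m + m := by exact_mod_cast hm
  rw [jacobiTheta₂_term, jacobiTheta₂_term, exp_eq_exp_iff_exists_int]
  exact ⟨m, by linear_combination (Real.pi * I : ℂ) * hm'⟩

lemma thetaTwo_add_one (τ : ℂ) : thetaTwo (τ + 1) = thetaTwo τ := by
  rw [thetaTwo, thetaTwo, ← jacobiTheta₂_half_add_one (τ / 2) τ]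
  congr 1; ring

lemma add_one_im_pos {τ : ℂ} (hτ : 0 < τ.im) : 0 < (τ + 1).im := by simpa using hτ

/-- Translation by 1 turns θ₃ into θ₄ and only changes the sign of the nome in Landen's formula. -/
lemma thetaThree_add_one_sq {τ : ℂ} (hτ : 0 < τ.im) :
    thetaThree (τ + 1) ^ 2 = thetaThree (2 * τ) ^ 2 - nome τ * thetaTwo (2 * τ) ^ 2 := by
  rw [thetaThree_sq (add_one_im_pos hτ), nome_add_one, show 2 * (τ + 1) = 2 * τ + 2 by ring,
    thetaThree_add_two, show 2 * τ + 2 = 2 * τ + 1 + 1 by ring, thetaTwo_add_one, thetaTwo_add_one]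
  ring

/-- Jacobi's identity `θ₃ ^ 4 = θ₄ ^ 4 + θ₂ ^ 4`. -/
lemma thetaThree_pow_four {τ : ℂ} (hτ : 0 < τ.im) :
    thetaThree τ ^ 4 = thetaThree (τ + 1) ^ 4 + nome τ * thetaTwo τ ^ 4 := by
  have h1 := thetaThree_sq hτ
  have h2 := thetaThree_add_one_sq hτ
  have h3 := thetaTwo_sq hτ
  -- With A = θ₃(2τ)² and B = p θ₂(2τ)², this is (A + B)² - (A - B)² = 4AB.
  rw [show thetaThree τ ^ 4 = (thetaThree τ ^ 2) ^ 2 by ring,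
    show thetaThree (τ + 1) ^ 4 = (thetaThree (τ + 1) ^ 2) ^ 2 by ring,
    show thetaTwo τ ^ 4 = (thetaTwo τ ^ 2) ^ 2 by ring, h1, h2, h3]
  ring

lemma one_sub_ellipticLambda {τ : ℂ} (hτ : 0 < τ.im) :
    1 - ellipticLambda τ = thetaThree (τ + 1) ^ 4 / thetaThree τ ^ 4 := by
  have h := thetaThree_ne_zero hτ
  rw [ellipticLambda_eq_theta hτ]
  field_simp
  linear_combination thetaThree_pow_four hτ

lemma ellipticLambda_add_one {τ : ℂ} (hτ : 0 < τ.im) :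
    ellipticLambda (τ + 1) = -ellipticLambda τ / (1 - ellipticLambda τ) := by
  have h1 := thetaThree_ne_zero hτ
  have h2 := thetaThree_ne_zero (add_one_im_pos hτ)
  rw [one_sub_ellipticLambda hτ, ellipticLambda_eq_theta hτ,
    ellipticLambda_eq_theta (add_one_im_pos hτ), nome_add_one, thetaTwo_add_one]
  field_simp

lemma neg_inv_im_pos {τ : ℂ} (hτ : 0 < τ.im) : 0 < (-1 / τ).im := by
  have h0 : τ ≠ 0 := by rintro rfl; simp at hτ
  rw [neg_div, neg_im, one_div, inv_im, neg_div, neg_neg]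
  exact div_pos hτ (normSq_pos.mpr h0)

/-- Inversion exchanges θ₂ and θ₄ and fixes θ₃ up to a common factor c, which cancels in the
quotient. -/
lemma ellipticLambda_neg_inv {τ : ℂ} (hτ : 0 < τ.im) :
    1 - ellipticLambda (-1 / τ) = ellipticLambda τ := by
  have h0 : τ ≠ 0 := by rintro rfl; simp at hτ
  have hI : -I * τ ≠ 0 := mul_ne_zero (neg_ne_zero.mpr I_ne_zero) h0
  have h1 := thetaThree_ne_zero hτ
  have h2 := thetaThree_ne_zero (neg_inv_im_pos hτ)
  set c : ℂ := 1 / (-I * τ) ^ (1 / 2 : ℂ) with hc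
  have hc0 : c ≠ 0 := one_div_ne_zero (by rw [Ne, cpow_eq_zero_iff]; tauto)
  have e3 : thetaThree τ = c * thetaThree (-1 / τ) := by
    have := jacobiTheta₂_functional_equation 0 τ
    simpa [thetaThree, hc] using this
  have e2 : nome τ * thetaTwo τ ^ 4 = c ^ 4 * thetaThree (-1 / τ + 1) ^ 4 := by
    have h := jacobiTheta₂_functional_equation (τ / 2) τ
    have e : jacobiTheta₂ (τ / 2 / τ) (-1 / τ) = thetaThree (-1 / τ + 1) := by
      rw [thetaThree, ← jacobiTheta₂_half_add_one, ← jacobiTheta₂_add_left 0,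
        show τ / 2 / τ + 1 / 2 = 0 + 1 by field_simp; norm_num]
    have en : nome τ * cexp (-Real.pi * I * (τ / 2) ^ 2 / τ) ^ 4 = 1 := by
      rw [nome, ← exp_nat_mul, ← exp_add, ← exp_zero]
      congr 1; push_cast; field_simp; ring
    rw [thetaTwo, h, e, ← hc]
    linear_combination c ^ 4 * thetaThree (-1 / τ + 1) ^ 4 * en
  rw [one_sub_ellipticLambda (neg_inv_im_pos hτ), ellipticLambda_eq_theta hτ, e2, e3]
  field_simp

/-- Landen's transformation for `λ`: `λ(τ) = 4 μ / (1 + μ) ^ 2` with `μ ^ 2 = λ(2 τ)`. -/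
lemma ellipticLambda_landen {τ : ℂ} (hτ : 0 < τ.im) :
    ∃ μ : ℂ, μ ^ 2 = ellipticLambda (2 * τ) ∧ 1 + μ ≠ 0 ∧
      ellipticLambda τ = 4 * μ / (1 + μ) ^ 2 := by
  have h2 := two_mul_im_pos hτ
  have n1 := thetaThree_ne_zero hτ
  have n2 := thetaThree_ne_zero h2
  have e : 1 + nome τ * thetaTwo (2 * τ) ^ 2 / thetaThree (2 * τ) ^ 2 =
      thetaThree τ ^ 2 / thetaThree (2 * τ) ^ 2 := by
    rw [thetaThree_sq hτ]; field_simp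
  refine ⟨nome τ * thetaTwo (2 * τ) ^ 2 / thetaThree (2 * τ) ^ 2, ?_, ?_, ?_⟩
  · rw [ellipticLambda_eq_theta h2, nome_two_mul]; ring
  · rw [e]; exact div_ne_zero (pow_ne_zero _ n1) (pow_ne_zero _ n2)
  · rw [e, ellipticLambda_eq_theta hτ, show thetaTwo τ ^ 4 = (thetaTwo τ ^ 2) ^ 2 by ring,
      thetaTwo_sq hτ]
    field_simp
    ring

/-! ### λ on the imaginary axis -/

/-- `∏ (1 + s ^ (2 n - 1))` over `n ≥ 1`, for real `s`. -/
noncomputable def oddAddProdReal (s : ℝ) : ℝ := ∏' n : ℕ, (1 + s ^ (2 * n + 1))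

lemma multipliable_one_add_odd_pow {s : ℝ} (hs : |s| < 1) :
    Multipliable fun n : ℕ => 1 + s ^ (2 * n + 1) := by
  refine multipliable_one_add_of_summable ?_
  have h := summable_norm_pow_mul_add (p := (s : ℂ)) (by simpa using hs) two_ne_zero 1
  simpa using h

lemma oddAddProd_ofReal {s : ℝ} (hs : |s| < 1) : oddAddProd (s : ℂ) = oddAddProdReal s := by
  have h := ((multipliable_one_add_odd_pow hs).hasProd.map ofRealHom continuous_ofReal).tprod_eq
  rw [oddAddProdReal, oddAddProd]
  refine Eq.trans (tprod_congr fun n => ?_) h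
  simp

lemma one_add_odd_pow_nonneg {s : ℝ} (hs : |s| < 1) (n : ℕ) : 0 ≤ 1 + s ^ (2 * n + 1) := by
  have h : |s ^ (2 * n + 1)| ≤ 1 := by
    rw [abs_pow]; exact pow_le_one₀ (abs_nonneg s) hs.le
  linarith [(abs_le.mp h).1]

/-- Odd powers are increasing on all of ℝ, so negative s is covered; `lambdaReal` uses both p and
-p. -/
lemma oddAddProdReal_mono {s t : ℝ} (hs : |s| < 1) (ht : |t| < 1) (hst : s ≤ t) :
    oddAddProdReal s ≤ oddAddProdReal t := by
  refine le_of_tendsto_of_tendsto' (multipliable_one_add_odd_pow hs).hasProd.tendsto_prod_nat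
    (multipliable_one_add_odd_pow ht).hasProd.tendsto_prod_nat fun n => ?_
  refine Finset.prod_le_prod (fun i _ => one_add_odd_pow_nonneg hs i) fun i _ => ?_
  have : s ^ (2 * i + 1) ≤ t ^ (2 * i + 1) := (Odd.strictMono_pow ⟨i, rfl⟩).monotone hst
  linarith

lemma oddAddProdReal_pos {s : ℝ} (hs : |s| < 1) : 0 < oddAddProdReal s := by
  refine lt_of_le_of_ne ?_ fun h => ?_
  · exact ge_of_tendsto' (multipliable_one_add_odd_pow hs).hasProd.tendsto_prod_nat
      fun n => Finset.prod_nonneg fun i _ => one_add_odd_pow_nonneg hs i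
  · refine oddAddProd_ne_zero (p := (s : ℂ)) (by simpa using hs) ?_
    rw [oddAddProd_ofReal hs, ← h, ofReal_zero]

lemma one_sub_ellipticLambda_eq_prod {τ : ℂ} (hτ : 0 < τ.im) :
    1 - ellipticLambda τ = (oddAddProd (-nome τ) / oddAddProd (nome τ)) ^ 8 := by
  have h := norm_nome_lt_one hτ
  have h1 := evenSubProd_ne_zero h
  have h2 := oddAddProd_ne_zero h
  have e : evenSubProd (-nome τ) = evenSubProd (nome τ) :=
    tprod_congr fun n => by rw [Even.neg_pow ⟨n + 1, by ring⟩]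
  rw [one_sub_ellipticLambda hτ, thetaThree_eq_prod hτ, thetaThree_eq_prod (add_one_im_pos hτ),
    nome_add_one, e]
  field_simp

/-- The value `λ(i y)` as a real number. -/
noncomputable def lambdaReal (y : ℝ) : ℝ :=
  1 - (oddAddProdReal (-Real.exp (-(Real.pi * y))) / oddAddProdReal (Real.exp (-(Real.pi * y)))) ^ 8

lemma abs_exp_neg_pi_mul_lt_one {y : ℝ} (hy : 0 < y) : |Real.exp (-(Real.pi * y))| < 1 := by
  rw [abs_of_pos (Real.exp_pos _), Real.exp_lt_one_iff]
  linarith [mul_pos Real.pi_pos hy]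

lemma mul_I_im_pos {y : ℝ} (hy : 0 < y) : 0 < ((y : ℂ) * I).im := by simpa using hy

lemma ellipticLambda_mul_I {y : ℝ} (hy : 0 < y) :
    ellipticLambda ((y : ℂ) * I) = lambdaReal y := by
  have hs := abs_exp_neg_pi_mul_lt_one hy
  have e : nome ((y : ℂ) * I) = (Real.exp (-(Real.pi * y)) : ℝ) := by
    rw [nome, ofReal_exp]; congr 1; push_cast
    linear_combination (Real.pi * y : ℂ) * I_mul_I
  have h := one_sub_ellipticLambda_eq_prod (mul_I_im_pos hy)
  rw [e, ← ofReal_neg, oddAddProd_ofReal hs, oddAddProd_ofReal (by rwa [abs_neg])] at h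
  rw [lambdaReal]
  push_cast at h ⊢
  linear_combination -h

lemma lambdaReal_antitone {y y' : ℝ} (hy : 0 < y) (h : y ≤ y') : lambdaReal y' ≤ lambdaReal y := by
  have hs := abs_exp_neg_pi_mul_lt_one hy
  have hs' := abs_exp_neg_pi_mul_lt_one (hy.trans_le h)
  have hle : Real.exp (-(Real.pi * y')) ≤ Real.exp (-(Real.pi * y)) := by
    rw [Real.exp_le_exp]
    linarith [mul_le_mul_of_nonneg_left h Real.pi_pos.le]
  have hn : |(-Real.exp (-(Real.pi * y)))| < 1 := by rwa [abs_neg]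
  have hn' : |(-Real.exp (-(Real.pi * y')))| < 1 := by rwa [abs_neg]
  have h1 := oddAddProdReal_mono hs' hs hle
  have h2 := oddAddProdReal_mono hn hn' (neg_le_neg hle)
  have p1 := oddAddProdReal_pos hs'
  have p2 := oddAddProdReal_pos hn
  have p3 := oddAddProdReal_pos hn'
  have p4 := oddAddProdReal_pos hs
  rw [lambdaReal, lambdaReal]
  gcongr

lemma lambdaReal_lt_one {y : ℝ} (hy : 0 < y) : lambdaReal y < 1 := by
  have hs := abs_exp_neg_pi_mul_lt_one hy
  have p1 := oddAddProdReal_pos hs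
  have p2 := oddAddProdReal_pos (s := -Real.exp (-(Real.pi * y))) (by rwa [abs_neg])
  rw [lambdaReal, sub_lt_self_iff]
  positivity

lemma lambdaReal_pos {y : ℝ} (hy : 0 < y) : 0 < lambdaReal y := by
  have hs := abs_exp_neg_pi_mul_lt_one hy
  have hn : |(-Real.exp (-(Real.pi * y)))| < 1 := by rwa [abs_neg]
  have p1 := oddAddProdReal_pos hs
  have p2 := oddAddProdReal_pos hn
  have h := oddAddProdReal_mono hn hs (by linarith [Real.exp_pos (-(Real.pi * y))])
  refine lt_of_le_of_ne ?_ fun h0 => ?_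
  · rw [lambdaReal, sub_nonneg]
    exact pow_le_one₀ (by positivity) ((div_le_one p1).mpr h)
  · apply ellipticLambda_ne_zero (mul_I_im_pos hy)
    rw [ellipticLambda_mul_I hy, ← h0, ofReal_zero]

/-! ### Special values, and j at (1 + √(-d))/2 -/

lemma lambdaReal_one : lambdaReal 1 = 1 / 2 := by
  have h := ellipticLambda_neg_inv (mul_I_im_pos one_pos)
  have e : -1 / (((1 : ℝ) : ℂ) * I) = ((1 : ℝ) : ℂ) * I := by
    rw [ofReal_one, one_mul, neg_div, one_div, inv_I, neg_neg]
  rw [e, ellipticLambda_mul_I one_pos] at h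
  have h' : 1 - lambdaReal 1 = lambdaReal 1 := by exact_mod_cast h
  linarith

lemma jd_eq {d : ℝ} (hd : 0 < d) :
    jd d = ((-16 * (1 - 16 * (lambdaReal √d * (1 - lambdaReal √d))) ^ 3 /
      (lambdaReal √d * (1 - lambdaReal √d)) : ℝ) : ℂ) := by
  have hy := Real.sqrt_pos.mpr hd
  have hτ : 0 < ((1 + sqrtNeg d) / 2).im := by simpa [sqrtNeg] using hd
  -- Doubling the argument gives √(-d) + 1, so μ² = -l/(1 - l) with l = λ(√(-d)). The sign of μ is
  -- immaterial, since j turns out to be even in μ.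
  obtain ⟨μ, hμ, h1, hl⟩ := ellipticLambda_landen hτ
  rw [show 2 * ((1 + sqrtNeg d) / 2) = (√d : ℂ) * I + 1 by rw [sqrtNeg]; ring,
    ellipticLambda_add_one (mul_I_im_pos hy), ellipticLambda_mul_I hy] at hμ
  have l0 : (lambdaReal √d : ℂ) ≠ 0 := ofReal_ne_zero.mpr (lambdaReal_pos hy).ne'
  have l1 : 1 - (lambdaReal √d : ℂ) ≠ 0 := by
    have : 1 - lambdaReal √d ≠ 0 := (sub_pos.mpr (lambdaReal_lt_one hy)).ne'
    exact_mod_cast this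
  rw [jd, ellipticJ, hl]
  push_cast
  generalize (lambdaReal √d : ℂ) = l at *
  have hμ0 : μ ≠ 0 := by
    rintro rfl
    rw [zero_pow two_ne_zero, eq_comm, div_eq_zero_iff, neg_eq_zero] at hμ
    tauto
  have hμ1 : 1 - μ ≠ 0 := by
    intro h
    rw [← sub_eq_zero.mp h, one_pow, eq_div_iff l1] at hμ
    exact one_ne_zero (by linear_combination hμ)
  have hm : μ ^ 2 * (1 - l) = -l := by rw [hμ]; field_simp
  have hm1 : (1 - μ ^ 2) * (1 - l) = 1 := by linear_combination -hm
  have hm10 : 1 - μ ^ 2 ≠ 0 := left_ne_zero_of_mul (hm1.trans_ne one_ne_zero)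
  have e1 : 1 - 4 * μ / (1 + μ) ^ 2 = (1 - μ) ^ 2 / (1 + μ) ^ 2 := by field_simp; ring
  have e2 : 1 - 4 * μ / (1 + μ) ^ 2 + (4 * μ / (1 + μ) ^ 2) ^ 2 =
      (1 + 14 * μ ^ 2 + (μ ^ 2) ^ 2) / (1 + μ) ^ 4 := by field_simp; ring
  rw [e2, e1]
  have e3 : 2 ^ 8 * ((1 + 14 * μ ^ 2 + (μ ^ 2) ^ 2) / (1 + μ) ^ 4) ^ 3 /
      ((4 * μ / (1 + μ) ^ 2) ^ 2 * ((1 - μ) ^ 2 / (1 + μ) ^ 2) ^ 2) =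
      16 * (1 + 14 * μ ^ 2 + (μ ^ 2) ^ 2) ^ 3 / (μ ^ 2 * (1 - μ ^ 2) ^ 4) := by
    rw [show 1 - μ ^ 2 = (1 - μ) * (1 + μ) by ring]
    field_simp
    ring
  rw [e3, hμ]
  have e4 : 1 - -l / (1 - l) = 1 / (1 - l) := by field_simp; ring
  have e5 : 1 + 14 * (-l / (1 - l)) + (-l / (1 - l)) ^ 2 =
      (1 - 16 * (l * (1 - l))) / (1 - l) ^ 2 := by field_simp; ring
  rw [e4, e5]
  field_simp

/-- The point ρ = exp(πi/3) is fixed by τ ↦ 1 - 1/τ, which forces λ(ρ)² - λ(ρ) + 1 = 0. -/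
lemma jd_three : jd 3 = 0 := by
  have hτ : 0 < ((1 + sqrtNeg 3) / 2).im := by simp [sqrtNeg]
  rw [jd, ellipticJ]
  set ρ := (1 + sqrtNeg 3) / 2 with hρ
  have h0 : ρ ≠ 0 := by intro h; rw [h] at hτ; simp at hτ
  have hsq : ρ ^ 2 - ρ + 1 = 0 := by
    have h3 : ((√3 : ℝ) : ℂ) ^ 2 = 3 := by
      rw [← ofReal_pow, Real.sq_sqrt (by norm_num)]; norm_num
    rw [hρ, sqrtNeg]
    linear_combination (1 / 4 : ℂ) * I ^ 2 * h3 + (3 / 4 : ℂ) * I_sq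
  have e : -1 / ρ + 1 = ρ := by
    field_simp
    linear_combination -hsq
  have hS := ellipticLambda_neg_inv hτ
  have hT := ellipticLambda_add_one (neg_inv_im_pos hτ)
  have hl := ellipticLambda_ne_zero hτ
  rw [hS, e, eq_div_iff hl] at hT
  have : 1 - ellipticLambda ρ + ellipticLambda ρ ^ 2 = 0 := by
    linear_combination hT + hS
  rw [this]
  simp

lemma lambdaReal_mul_one_sub_le {d : ℝ} (hd : 3 ≤ d) :
    lambdaReal √d * (1 - lambdaReal √d) ≤ 1 / 16 ∧ lambdaReal √d ≤ 1 / 2 := by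
  have h3 : 0 < √(3 : ℝ) := by positivity
  have p3 := lambdaReal_pos h3
  have q3 := lambdaReal_lt_one h3
  have hx : lambdaReal √3 * (1 - lambdaReal √3) = 1 / 16 := by
    have h := jd_eq (d := 3) (by norm_num)
    rw [jd_three, eq_comm, ofReal_eq_zero, div_eq_zero_iff] at h
    have hne : lambdaReal √3 * (1 - lambdaReal √3) ≠ 0 := (mul_pos p3 (by linarith)).ne'
    have h' := (mul_eq_zero.mp (h.resolve_right hne)).resolve_left (by norm_num)
    linarith [pow_eq_zero_iff (three_ne_zero) |>.mp h']
  have h1 : lambdaReal √d ≤ lambdaReal √3 := lambdaReal_antitone h3 (Real.sqrt_le_sqrt hd)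
  have h2 : lambdaReal √3 ≤ 1 / 2 := by
    rw [← lambdaReal_one]
    exact lambdaReal_antitone one_pos (Real.one_le_sqrt.mpr (by norm_num))
  refine ⟨?_, h1.trans h2⟩
  rw [← hx]
  nlinarith

/-! ### Radicals as rational functions of b -/

lemma csqrt_sq_ofReal {y : ℝ} (hy : 0 ≤ y) : csqrt ((y ^ 2 : ℝ) : ℂ) = y := by
  rw [csqrt, show (1 / 2 : ℂ) = ((1 / 2 : ℝ) : ℂ) by push_cast; rfl,
    ← ofReal_cpow (by positivity), ← Real.sqrt_eq_rpow, Real.sqrt_sq hy]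

lemma ccbrt_cube_ofReal {y : ℝ} (hy : 0 ≤ y) : ccbrt ((y ^ 3 : ℝ) : ℂ) = y := by
  rw [ccbrt, show (1 / 3 : ℂ) = ((1 / 3 : ℝ) : ℂ) by push_cast; rfl,
    ← ofReal_cpow (by positivity), ← Real.rpow_natCast, ← Real.rpow_mul hy]
  norm_num

/-- The negative of the `j`-invariant as a function of `b = 2 α`. -/
noncomputable def negJ (b : ℝ) : ℝ := 64 * (b ^ 2 - 3) ^ 3 / (b ^ 2 + 1) ^ 2

lemma exists_alphad_jd {d : ℝ} (hd : 3 ≤ d) :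
    ∃ b : ℝ, √3 ≤ b ∧ alphad d = ((b / 2 : ℝ) : ℂ) ∧ jd d = ((-negJ b : ℝ) : ℂ) := by
  have hd0 : 0 < d := by linarith
  have hy := Real.sqrt_pos.mpr hd0
  have hα : alphad d = 1 / 4 *
      (csqrt ((1 - (lambdaReal √d : ℂ)) / lambdaReal √d) -
        csqrt (lambdaReal √d / (1 - (lambdaReal √d : ℂ)))) := by
    rw [alphad, sqrtNeg, ellipticLambda_mul_I hy]
  rw [hα, jd_eq hd0]
  obtain ⟨hx, h2⟩ := lambdaReal_mul_one_sub_le hd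
  have h0 := lambdaReal_pos hy
  generalize lambdaReal √d = l at *
  have h1 : 0 < 1 - l := by linarith
  have hu := Real.sq_sqrt (div_pos h1 h0).le
  have hv := Real.sq_sqrt (div_pos h0 h1).le
  have hu0 := Real.sqrt_nonneg ((1 - l) / l)
  have hv0 := Real.sqrt_nonneg (l / (1 - l))
  have huv : √((1 - l) / l) * √(l / (1 - l)) = 1 := by
    rw [← Real.sqrt_mul (div_pos h1 h0).le, div_mul_div_cancel₀ h0.ne', div_self h1.ne',
      Real.sqrt_one]
  have hle : √(l / (1 - l)) ≤ √((1 - l) / l) := by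
    apply Real.sqrt_le_sqrt
    rw [div_le_div_iff₀ h1 h0]
    nlinarith
  have eu : csqrt ((1 - (l : ℂ)) / l) = √((1 - l) / l) := by
    rw [← csqrt_sq_ofReal hu0, hu]; push_cast; rfl
  have ev : csqrt (l / (1 - (l : ℂ))) = √(l / (1 - l)) := by
    rw [← csqrt_sq_ofReal hv0, hv]; push_cast; rfl
  rw [eu, ev]
  generalize √((1 - l) / l) = u at *
  generalize √(l / (1 - l)) = v at *
  -- Since uv = 1, only u² + v² - 2 remains, which is rational in l.
  have hb : ((u - v) / 2) ^ 2 = 1 / (4 * (l * (1 - l))) - 1 := by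
    have : ((u - v) / 2) ^ 2 = (u ^ 2 + v ^ 2 - 2 * (u * v)) / 4 := by ring
    rw [this, hu, hv, huv]
    field_simp
    ring
  have hxpos : 0 < l * (1 - l) := mul_pos h0 h1
  refine ⟨(u - v) / 2, ?_, by push_cast; ring, ?_⟩
  · apply Real.sqrt_le_iff.mpr
    refine ⟨by linarith, ?_⟩
    rw [hb, le_sub_iff_add_le, le_div_iff₀ (by positivity)]
    linarith
  · congr 1
    rw [negJ, hb]
    generalize l * (1 - l) = x at *
    field_simp
    ring

lemma pos_and_sq_of_sqrt_three_le {b : ℝ} (hb : √3 ≤ b) : 0 < b ∧ 0 ≤ b ^ 2 - 3 ∧ 0 ≤ b - √3 := by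
  have h := Real.sq_sqrt (show (0 : ℝ) ≤ 3 by norm_num)
  have h0 : 0 < √(3 : ℝ) := by positivity
  exact ⟨h0.trans_le hb, by nlinarith, by linarith⟩

/-- The radical `√(1728 - j)` in terms of `b`. -/
noncomputable def sqrtRad (b : ℝ) : ℝ := 8 * b * (b ^ 2 + 9) / (b ^ 2 + 1)

/-- The radical `(β ± 24 √3 j) ^ (1 / 3)` in terms of `b`, with `ε = ∓√3`. -/
noncomputable def cbrtRad (b ε : ℝ) : ℝ := 8 * (b ^ 2 - 3) * (b + ε) / (b ^ 2 + 1)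

/-- The two cube roots in the definition of `t` in terms of `b`, with `ε = ±√3`. -/
noncomputable def cbrtRadT (b ε : ℝ) : ℝ :=
  64 * (b ^ 2 - 3) * (b ^ 4 + 6 * b ^ 2 - 3 + 8 * ε * b) / (b ^ 2 + 1) ^ 2

lemma sqrtRad_sq (b : ℝ) : sqrtRad b ^ 2 = 1728 + negJ b := by
  have : b ^ 2 + 1 ≠ 0 := by positivity
  rw [sqrtRad, negJ]; field_simp; ring

lemma cbrtRad_cube (b : ℝ) {ε : ℝ} (hε : ε ^ 2 = 3) :
    cbrtRad b ε ^ 3 = negJ b * sqrtRad b + 24 * ε * negJ b := by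
  have : b ^ 2 + 1 ≠ 0 := by positivity
  have e : (b + ε) ^ 3 = b * (b ^ 2 + 9) + 3 * ε * (b ^ 2 + 1) := by
    linear_combination (3 * b + ε) * hε
  rw [cbrtRad, sqrtRad, negJ, div_pow, mul_pow, e]; field_simp; ring

lemma cbrtRadT_cube (b : ℝ) {ε : ℝ} (hε : ε ^ 2 = 3) :
    cbrtRadT b ε ^ 3 = 884736 * negJ b + 2304 * negJ b ^ 2 + negJ b ^ 3 +
      12288 * ε * (negJ b * sqrtRad b) := by
  have : b ^ 2 + 1 ≠ 0 := by positivity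
  have e : (b ^ 4 + 6 * b ^ 2 - 3 + 8 * ε * b) ^ 3 =
      (b ^ 4 + 6 * b ^ 2 - 3) ^ 3 + 576 * b ^ 2 * (b ^ 4 + 6 * b ^ 2 - 3) +
        ε * (24 * b * (b ^ 4 + 6 * b ^ 2 - 3) ^ 2 + 1536 * b ^ 3) := by
    linear_combination (192 * b ^ 2 * (b ^ 4 + 6 * b ^ 2 - 3) + 512 * ε * b ^ 3) * hε
  rw [cbrtRadT, sqrtRad, negJ, div_pow, mul_pow, e]; field_simp; ring

lemma negJ_nonneg {b : ℝ} (hb : √3 ≤ b) : 0 ≤ negJ b := by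
  obtain ⟨_, h, _⟩ := pos_and_sq_of_sqrt_three_le hb
  rw [negJ]; positivity

lemma sqrtRad_nonneg {b : ℝ} (hb : √3 ≤ b) : 0 ≤ sqrtRad b := by
  obtain ⟨h, _, _⟩ := pos_and_sq_of_sqrt_three_le hb
  rw [sqrtRad]; positivity

lemma cbrtRad_nonneg {b ε : ℝ} (hb : √3 ≤ b) (hε : -√3 ≤ ε) : 0 ≤ cbrtRad b ε := by
  obtain ⟨_, h, _⟩ := pos_and_sq_of_sqrt_three_le hb
  have : 0 ≤ b + ε := by linarith
  rw [cbrtRad]; positivity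

lemma cbrtRadT_nonneg {b ε : ℝ} (hb : √3 ≤ b) (hε : -√3 ≤ ε) : 0 ≤ cbrtRadT b ε := by
  obtain ⟨h0, h, h1⟩ := pos_and_sq_of_sqrt_three_le hb
  have h3 := Real.sq_sqrt (show (0 : ℝ) ≤ 3 by norm_num)
  have hs : 0 ≤ √(3 : ℝ) := Real.sqrt_nonneg 3
  -- In the extreme case ε = -√3 the quartic vanishes at b = √3; the factor b - √3 is split off.
  have e : b ^ 4 + 6 * b ^ 2 - 3 + 8 * ε * b =
      (b - √3) * (b ^ 3 + √3 * b ^ 2 + 9 * b + √3) + 8 * b * (ε + √3) := by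
    linear_combination (b ^ 2 + 1) * h3
  have : 0 ≤ b ^ 4 + 6 * b ^ 2 - 3 + 8 * ε * b := by
    rw [e]
    have : 0 ≤ ε + √3 := by linarith
    positivity
  rw [cbrtRadT]; positivity

lemma radical_sum_first (b : ℝ) : sqrtRad b + cbrtRad b (√3) + cbrtRad b (-√3) = 24 * b := by
  have : b ^ 2 + 1 ≠ 0 := by positivity
  rw [sqrtRad, cbrtRad, cbrtRad]; field_simp; ring

lemma radical_sum_second (b : ℝ) :
    (√3 * (cbrtRad b (√3) - cbrtRad b (-√3)) + 24) ^ 2 + 1152 + 9 * negJ b = (24 * b) ^ 2 := by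
  have : b ^ 2 + 1 ≠ 0 := by positivity
  have e : √3 * (cbrtRad b (√3) - cbrtRad b (-√3)) = 48 * (b ^ 2 - 3) / (b ^ 2 + 1) := by
    have h3 := Real.sq_sqrt (show (0 : ℝ) ≤ 3 by norm_num)
    rw [cbrtRad, cbrtRad]; field_simp
    linear_combination 16 * (b ^ 2 - 3) * h3
  rw [e, negJ]; field_simp; ring

lemma radical_sum_third (b : ℝ) :
    3 * (cbrtRadT b (-√3) + cbrtRadT b (√3)) + 1728 + 3 * negJ b = (24 * b) ^ 2 := by
  have : b ^ 2 + 1 ≠ 0 := by positivity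
  rw [cbrtRadT, cbrtRadT, negJ]; field_simp; ring

lemma closedForms {d b : ℝ} (hb : √3 ≤ b) (hj : jd d = ((-negJ b : ℝ) : ℂ)) :
    ad d = ((b / 2 : ℝ) : ℂ) ∧ bd d = ((b / 2 : ℝ) : ℂ) ∧ cd d = ((b / 2 : ℝ) : ℂ) := by
  have h3 := Real.sq_sqrt (show (0 : ℝ) ≤ 3 by norm_num)
  have h3' : (-√(3 : ℝ)) ^ 2 = 3 := by rw [neg_sq, h3]
  have hle : -√(3 : ℝ) ≤ √3 := by linarith [Real.sqrt_nonneg 3]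
  have hJ := negJ_nonneg hb
  have hS := sqrtRad_nonneg hb
  have hb0 := (pos_and_sq_of_sqrt_three_le hb).1
  have hβ : betad d = ((negJ b * sqrtRad b : ℝ) : ℂ) := by
    rw [betad, hj, ← csqrt_sq_ofReal (mul_nonneg hJ hS), mul_pow, sqrtRad_sq]
    congr 1; push_cast; ring
  have hs : csqrt (1728 - jd d) = sqrtRad b := by
    rw [hj, ← csqrt_sq_ofReal hS, sqrtRad_sq]; congr 1; push_cast; ring
  have hp : ccbrt (betad d - 24 * sqrt3 * jd d) = cbrtRad b (√3) := by
    rw [hβ, hj, sqrt3, ← ccbrt_cube_ofReal (cbrtRad_nonneg hb hle), cbrtRad_cube b h3]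
    congr 1; push_cast; ring
  have hm : ccbrt (betad d + 24 * sqrt3 * jd d) = cbrtRad b (-√3) := by
    rw [hβ, hj, sqrt3, ← ccbrt_cube_ofReal (cbrtRad_nonneg hb le_rfl), cbrtRad_cube b h3']
    congr 1; push_cast; ring
  have htp : ccbrt (-884736 * jd d + 2304 * jd d ^ 2 - jd d ^ 3 + 12288 * sqrt3 * betad d) =
      cbrtRadT b (√3) := by
    rw [hβ, hj, sqrt3, ← ccbrt_cube_ofReal (cbrtRadT_nonneg hb hle), cbrtRadT_cube b h3]
    congr 1; push_cast; ring
  have htm : ccbrt (-884736 * jd d + 2304 * jd d ^ 2 - jd d ^ 3 - 12288 * sqrt3 * betad d) =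
      cbrtRadT b (-√3) := by
    rw [hβ, hj, sqrt3, ← ccbrt_cube_ofReal (cbrtRadT_nonneg hb le_rfl), cbrtRadT_cube b h3']
    congr 1; push_cast; ring
  have h24 : csqrt (((24 * b) ^ 2 : ℝ) : ℂ) = ((24 * b : ℝ) : ℂ) := csqrt_sq_ofReal (by positivity)
  refine ⟨?_, ?_, ?_⟩
  · rw [ad, hs, hp, hm, ← ofReal_add, ← ofReal_add, radical_sum_first]
    push_cast; ring
  · have e : (sqrt3 * ((cbrtRad b (√3) : ℂ) - cbrtRad b (-√3)) + 24) ^ 2 + 1152 - 9 * jd d =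
        (((24 * b) ^ 2 : ℝ) : ℂ) := by
      rw [← radical_sum_second, hj, sqrt3]; push_cast; ring
    rw [bd, hp, hm, e, h24]
    push_cast; ring
  · have e : -2304 * td d + 1728 - 3 * jd d = (((24 * b) ^ 2 : ℝ) : ℂ) := by
      rw [td, htp, htm, ← radical_sum_third, hj]; push_cast; ring
    rw [cd, e, h24]
    push_cast; ring

/-! ### The numerical case d = 11 -/

lemma continuous_negJ : Continuous negJ := by
  unfold negJ
  exact Continuous.div (by fun_prop) (by fun_prop) fun b => by positivity

/-- The solution of the modular equation for the class number one discriminant `-11`, with its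
decimal expansion. -/
lemma exists_negJ_eq : ∃ b : ℝ, √3 ≤ b ∧ negJ b = 32768 ∧
    68.60158545708098436381847267122362501672364940828 < 3 * b ∧
    3 * b < 68.60158545708098436381847267122362501672364940829 := by
  have hs : √(3 : ℝ) ≤ 2 := by rw [Real.sqrt_le_iff]; norm_num
  have h1 : negJ (68.60158545708098436381847267122362501672364940828 / 3) < 32768 := by
    rw [negJ]; norm_num
  have h2 : 32768 < negJ (68.60158545708098436381847267122362501672364940829 / 3) := by
    rw [negJ]; norm_num
  obtain ⟨b, ⟨hb1, hb2⟩, hb⟩ := intermediate_value_Ioo (by norm_num) continuous_negJ.continuousOn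
    (show (32768 : ℝ) ∈ Set.Ioo _ _ from ⟨h1, h2⟩)
  refine ⟨b, hs.trans (le_trans (by norm_num) hb1.le), hb, ?_, ?_⟩ <;> linarith

lemma cube_rpow_third {x y : ℝ} (hy : 0 ≤ y) (h : y ^ 3 = x) : x ^ (1 / 3 : ℝ) = y := by
  rw [← h, ← Real.rpow_natCast, ← Real.rpow_mul hy]; norm_num

/-- The general radicals at -j = 32768, rescaled: the cube roots by 64 and 1024, and 24b = 8 · 3b.
Any such b serves, so its uniqueness is not needed. -/
lemma radicals_eleven {b : ℝ} (hb : √3 ≤ b) (hJ : negJ b = 32768) :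
    7 * √(11 : ℝ) + 8 * ((7 * √11 + 3 * √3) ^ (1 / 3 : ℝ) + (7 * √11 - 3 * √3) ^ (1 / 3 : ℝ)) =
      3 * b ∧
    √((8 * √3 * ((7 * √11 + 3 * √3) ^ (1 / 3 : ℝ) - (7 * √11 - 3 * √3) ^ (1 / 3 : ℝ)) + 3) ^ 2
      + 4626) = 3 * b ∧
    √(48 * ((35099 + 21 * √(33 : ℝ)) ^ (1 / 3 : ℝ) + (35099 - 21 * √33) ^ (1 / 3 : ℝ)) + 1563) =
      3 * b := by
  have h3 := Real.sq_sqrt (show (0 : ℝ) ≤ 3 by norm_num)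
  have h3' : (-√(3 : ℝ)) ^ 2 = 3 := by rw [neg_sq, h3]
  have hle : -√(3 : ℝ) ≤ √3 := by linarith [Real.sqrt_nonneg 3]
  have hb0 := (pos_and_sq_of_sqrt_three_le hb).1
  have hS : sqrtRad b = 56 * √11 := by
    have h11 := Real.sq_sqrt (show (0 : ℝ) ≤ 11 by norm_num)
    refine (sq_eq_sq₀ (sqrtRad_nonneg hb) (by positivity)).mp ?_
    rw [sqrtRad_sq, hJ, mul_pow, h11]; norm_num
  have h33 : √(33 : ℝ) = √3 * √11 := by
    rw [← Real.sqrt_mul (by norm_num)]; norm_num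
  have hp : (7 * √11 + 3 * √3) ^ (1 / 3 : ℝ) = cbrtRad b (√3) / 64 := by
    refine cube_rpow_third (div_nonneg (cbrtRad_nonneg hb hle) (by norm_num)) ?_
    rw [div_pow, cbrtRad_cube b h3, hJ, hS]; ring
  have hm : (7 * √11 - 3 * √3) ^ (1 / 3 : ℝ) = cbrtRad b (-√3) / 64 := by
    refine cube_rpow_third (div_nonneg (cbrtRad_nonneg hb le_rfl) (by norm_num)) ?_
    rw [div_pow, cbrtRad_cube b h3', hJ, hS]; ring
  have htp : (35099 + 21 * √(33 : ℝ)) ^ (1 / 3 : ℝ) = cbrtRadT b (√3) / 1024 := by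
    refine cube_rpow_third (div_nonneg (cbrtRadT_nonneg hb hle) (by norm_num)) ?_
    rw [div_pow, cbrtRadT_cube b h3, hJ, hS, h33]; ring
  have htm : (35099 - 21 * √(33 : ℝ)) ^ (1 / 3 : ℝ) = cbrtRadT b (-√3) / 1024 := by
    refine cube_rpow_third (div_nonneg (cbrtRadT_nonneg hb le_rfl) (by norm_num)) ?_
    rw [div_pow, cbrtRadT_cube b h3', hJ, hS, h33]; ring
  have e1 := radical_sum_first b
  have e2 := radical_sum_second b
  have e3 := radical_sum_third b
  rw [hS] at e1
  rw [hJ] at e2 e3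
  rw [hp, hm, htp, htm]
  refine ⟨by linarith, ?_, ?_⟩ <;> rw [Real.sqrt_eq_iff_mul_self_eq (by nlinarith) (by positivity)]
  · linear_combination (1 / 64 : ℝ) * e2
  · linear_combination (1 / 64 : ℝ) * e3

end CubicIdentities

theorem mainTheorem2 :
    (∀ d : ℝ, 3 ≤ d →
      CubicIdentities.alphad d = CubicIdentities.ad d ∧
      CubicIdentities.ad d = CubicIdentities.bd d ∧
      CubicIdentities.bd d = CubicIdentities.cd d ∧
      ∃ r : ℝ, 0 ≤ r ∧ CubicIdentities.alphad d = (r : ℂ)) ∧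
    (7 * √(11 : ℝ) + 8 * ((7 * √11 + 3 * √3) ^ (1 / 3 : ℝ) + (7 * √11 - 3 * √3) ^ (1 / 3 : ℝ))
        = √((8 * √3 * ((7 * √11 + 3 * √3) ^ (1 / 3 : ℝ) - (7 * √11 - 3 * √3) ^ (1 / 3 : ℝ)) + 3) ^ 2
            + 4626) ∧
      √((8 * √3 * ((7 * √11 + 3 * √3) ^ (1 / 3 : ℝ) - (7 * √11 - 3 * √3) ^ (1 / 3 : ℝ)) + 3) ^ 2
            + 4626)
        = √(48 * ((35099 + 21 * √(33 : ℝ)) ^ (1 / 3 : ℝ) + (35099 - 21 * √33) ^ (1 / 3 : ℝ))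
            + 1563) ∧
      68.60158545708098436381847267122362501672364940828
        < √(48 * ((35099 + 21 * √(33 : ℝ)) ^ (1 / 3 : ℝ) + (35099 - 21 * √33) ^ (1 / 3 : ℝ))
            + 1563) ∧
      √(48 * ((35099 + 21 * √(33 : ℝ)) ^ (1 / 3 : ℝ) + (35099 - 21 * √33) ^ (1 / 3 : ℝ)) + 1563)
        < 68.60158545708098436381847267122362501672364940829) := by

  refine ⟨fun d hd => ?_, ?_⟩
  · obtain ⟨b, hb, hα, hj⟩ := CubicIdentities.exists_alphad_jd hd
    obtain ⟨ha, hb', hc⟩ := CubicIdentities.closedForms hb hj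
    rw [hα, ha, hb', hc]
    exact ⟨rfl, rfl, rfl, b / 2, by linarith [Real.sqrt_nonneg 3], rfl⟩
  · obtain ⟨b, hb, hJ, hlo, hhi⟩ := CubicIdentities.exists_negJ_eq
    obtain ⟨h1, h2, h3⟩ := CubicIdentities.radicals_eleven hb hJ
    rw [h1, h2, h3]
    exact ⟨rfl, rfl, hlo, hhi⟩
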